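/- Fix natural numbers $N$ (number of measurement settings) and $K$ (number of outcomes). For a Hilbert space $\mathcal H$, a \emph{projective measurement} on $\mathcal H$ with $K$ outcomes is a family $(E_c)_{c=1}^K$ of self-adjoint operators in $B(\mathcal H)$ with $E_cE_{c'}=\delta_{cc'}E_c$ for all $c,c'$ and $\sum_{c=1}^K E_c=1$; a \emph{POVM} with $K$ outcomes is a family $(E_c)_{c=1}^K$ in $B(\mathcal H)$ with $E_c\ge 0$ for all $c$ and $\sum_{c=1}^K E_c=1$. A \emph{state} on $B(\mathcal H)$ is a positive linear functional $\omega:B(\mathcal H)\to\mathbb C$ with $\omega(1)=1$ (not necessarily normal). Let $Q$ be the set of all families $(p(a,b|x,y))_{a,b=1,\dots,K;\;x,y=1,\dots,N}$ of real numbers for which there are complex Hilbert spaces $\mathcal H_A,\mathcal H_B$, projective measurements $(E^x_a)_{a=1}^K$ on $\mathcal H_A$ ($x=1,\dots,N$) and $(F^y_b)_{b=1}^K$ on $\mathcal H_B$ ($y=1,\dots,N$), and a state $\omega$ on $B(\mathcal H_A\otimes\mathcal H_B)$ such that $p(a,b|x,y)=\omega(E^x_a\otimes F^y_b)$ for all $a,b,x,y$.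 Let $Q'$ be the set of all such families for which there are one complex Hilbert space $\mathcal H$, projective measurements $(E^x_a)_{a=1}^K$ and $(F^y_b)_{b=1}^K$ on $\mathcal H$ ($x,y=1,\dots,N$) with $E^x_aF^y_b=F^y_bE^x_a$ for all $a,b,x,y$, and a state $\omega$ on $B(\mathcal H)$ such that $p(a,b|x,y)=\omega(E^x_aF^y_b)$ for all $a,b,x,y$. Let $Q_{\mathrm{POVM}}$ and $Q'_{\mathrm{POVM}}$ be defined in the same way as $Q$ and $Q'$, with arbitrary POVMs in place of projective measurements. Then $$Q=Q_{\mathrm{POVM}}\qquad\text{and}\qquad Q'=Q'_{\mathrm{POVM}}.$$ -/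

import Mathlib

open scoped TensorProduct ComplexOrder

universe u

namespace Tsirelson

/-- A behavior: the array of numbers `p a b x y = p(a,b|x,y)`, for outcomes `a, b` among `K` and
measurement settings `x, y` among `N`. -/
abbrev Behavior (N K : ℕ) : Type := Fin K → Fin K → Fin N → Fin N → ℝ

section Measurements

variable {H : Type u} [NormedAddCommGroup H] [InnerProductSpace ℂ H] [CompleteSpace H] {K : ℕ}

/-- A projective measurement with `K` outcomes on a Hilbert space: self-adjoint operators `E c` with
`E c * E c' = δ_{c c'} E c` (so mutually orthogonal orthogonal projections) that sum to `1`. -/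
structure IsProjectiveMeasurement (E : Fin K → H →L[ℂ] H) : Prop where
  selfAdjoint : ∀ c, IsSelfAdjoint (E c)
  orthogonal : ∀ c c', E c * E c' = if c = c' then E c else 0
  complete : ∑ c, E c = 1

/-- A positive operator valued measure (POVM) with `K` outcomes on a Hilbert space. -/
structure IsPOVM (E : Fin K → H →L[ℂ] H) : Prop where
  positive : ∀ c, (E c).IsPositive
  complete : ∑ c, E c = 1

end Measurements

/-- A state on `B(H)`: a positive linear functional (not required to be normal) with value `1` at
the identity. Positivity refers to the Loewner order on operators. -/
structure State (H : Type u) [NormedAddCommGroup H] [InnerProductSpace ℂ H] [CompleteSpace H] where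
  toFunctional : (H →L[ℂ] H) →ₚ[ℂ] ℂ
  map_one : toFunctional 1 = 1

section TensorProducts

variable (HA HB : Type u) [NormedAddCommGroup HA] [InnerProductSpace ℂ HA]
  [NormedAddCommGroup HB] [InnerProductSpace ℂ HB]

/-- The Hilbert space tensor product: the completion of the algebraic tensor product with respect to
its inner product. -/
abbrev HilbertTensor : Type u := UniformSpace.Completion (HA ⊗[ℂ] HB)

variable {HA HB}

/-- The bounded operator `S ⊗ T` on the Hilbert space tensor product. -/
noncomputable def opTensor (S : HA →L[ℂ] HA) (T : HB →L[ℂ] HB) :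
    HilbertTensor HA HB →L[ℂ] HilbertTensor HA HB :=
  (TensorProduct.mapL S T).completion

/-- The operator `S ⊗ T` acts on elementary tensors by `v ⊗ w ↦ S v ⊗ T w`. -/
theorem opTensor_coe_tmul (S : HA →L[ℂ] HA) (T : HB →L[ℂ] HB) (v : HA) (w : HB) :
    opTensor S T ((v ⊗ₜ[ℂ] w : HA ⊗[ℂ] HB) : HilbertTensor HA HB) =
      ((S v ⊗ₜ[ℂ] T w : HA ⊗[ℂ] HB) : HilbertTensor HA HB) := by
  simp [opTensor]

end TensorProducts

section Correlations

variable (N K : ℕ)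

/-- The tensor set `Q` of quantum correlations, with projective measurements: the behaviors
`p(a,b|x,y) = ω (E^x_a ⊗ F^y_b)`. -/
def tensorSet : Set (Behavior N K) :=
  {p | ∃ (HA : Type u) (_ : NormedAddCommGroup HA) (_ : InnerProductSpace ℂ HA)
      (_ : CompleteSpace HA)
      (HB : Type u) (_ : NormedAddCommGroup HB) (_ : InnerProductSpace ℂ HB)
      (_ : CompleteSpace HB)
      (E : Fin N → Fin K → HA →L[ℂ] HA) (F : Fin N → Fin K → HB →L[ℂ] HB)
      (ω : State (HilbertTensor HA HB)),
      (∀ x, IsProjectiveMeasurement (E x)) ∧ (∀ y, IsProjectiveMeasurement (F y)) ∧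
      ∀ a b x y, (p a b x y : ℂ) = ω.toFunctional (opTensor (E x a) (F y b))}

/-- The tensor set of quantum correlations, with general POVMs. -/
def tensorSetPOVM : Set (Behavior N K) :=
  {p | ∃ (HA : Type u) (_ : NormedAddCommGroup HA) (_ : InnerProductSpace ℂ HA)
      (_ : CompleteSpace HA)
      (HB : Type u) (_ : NormedAddCommGroup HB) (_ : InnerProductSpace ℂ HB)
      (_ : CompleteSpace HB)
      (E : Fin N → Fin K → HA →L[ℂ] HA) (F : Fin N → Fin K → HB →L[ℂ] HB)
      (ω : State (HilbertTensor HA HB)),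
      (∀ x, IsPOVM (E x)) ∧ (∀ y, IsPOVM (F y)) ∧
      ∀ a b x y, (p a b x y : ℂ) = ω.toFunctional (opTensor (E x a) (F y b))}

/-- The commuting set `Q'` of quantum correlations, with projective measurements: the behaviors
`p(a,b|x,y) = ω (E^x_a F^y_b)`, where all `E^x_a` commute with all `F^y_b`. -/
def commutingSet : Set (Behavior N K) :=
  {p | ∃ (H : Type u) (_ : NormedAddCommGroup H) (_ : InnerProductSpace ℂ H)
      (_ : CompleteSpace H)
      (E F : Fin N → Fin K → H →L[ℂ] H) (ω : State H),
      (∀ x, IsProjectiveMeasurement (E x)) ∧ (∀ y, IsProjectiveMeasurement (F y)) ∧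
      (∀ a b x y, Commute (E x a) (F y b)) ∧
      ∀ a b x y, (p a b x y : ℂ) = ω.toFunctional (E x a * F y b)}

/-- The commuting set of quantum correlations, with general POVMs. -/
def commutingSetPOVM : Set (Behavior N K) :=
  {p | ∃ (H : Type u) (_ : NormedAddCommGroup H) (_ : InnerProductSpace ℂ H)
      (_ : CompleteSpace H)
      (E F : Fin N → Fin K → H →L[ℂ] H) (ω : State H),
      (∀ x, IsPOVM (E x)) ∧ (∀ y, IsPOVM (F y)) ∧
      (∀ a b x y, Commute (E x a) (F y b)) ∧
      ∀ a b x y, (p a b x y : ℂ) = ω.toFunctional (E x a * F y b)}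

end Correlations

end Tsirelson

/-! Projective measurements are POVMs, so only the converse inclusions need work, by a Naimark
dilation. For a POVM `E` on `H`, take `K + 1` copies of `H`, with embedding `s` as the distinguished
summand and isometry `V v = (√E_a v)_a` into the other `K`. The ranges of `s` and `V` are
orthogonal, so a self-adjoint unitary `U` exchanges them; conjugating the block projections by `U`
gives a projective measurement with compression `E` along `s` (`IsPOVM.compression_dilation`).

Neither the space nor `s` depends on `E`, so all settings are dilated at once and `ω (s† · s)` is a
single state serving them all. In the tensor case both factors are dilated and compressed along `s ⊗
t`. In the commuting case the dilation commutes with `1 ⊗ T` for each `T` commuting with `E`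
(`IsPOVM.commute_dilation`), so the parties are dilated in turn. -/

namespace Tsirelson

/-! ### Block-diagonal operators on finitely many copies of a Hilbert space. -/

section Dilation

open ContinuousLinearMap
open scoped InnerProduct

variable {H : Type u} [NormedAddCommGroup H] [InnerProductSpace ℂ H]
  {ι : Type} [Fintype ι] [DecidableEq ι]

/-- The inclusion of `H` as the `i`-th summand of the Hilbert sum of copies of `H`. -/
noncomputable def summand (H : Type u) [NormedAddCommGroup H] [InnerProductSpace ℂ H]
    (i : ι) : H →L[ℂ] PiLp 2 (fun _ : ι => H) :=
  LinearMap.mkContinuous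
    { toFun := fun v => PiLp.single 2 i v
      map_add' := fun _ _ => PiLp.single_add 2 i
      map_smul' := fun c v => by
        ext j
        by_cases h : j = i
        · subst h; simp
        · simp [h] } 1 (fun v => by simp)

theorem summand_apply (i : ι) (v : H) : summand H i v = PiLp.single 2 i v := rfl

variable [CompleteSpace H]

theorem adjoint_summand_apply (i : ι) (w : PiLp 2 (fun _ : ι => H)) :
    ((summand H i)†) w = w i := by
  refine ext_inner_left ℂ fun v => ?_
  rw [adjoint_inner_right, summand_apply, PiLp.inner_apply, Finset.sum_eq_single i]
  · simp
  · intro j _ hj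
    simp [hj]
  · simp

theorem adjoint_summand_comp (i j : ι) :
    (summand H i)† ∘L summand H j = if i = j then 1 else 0 := by
  ext v
  rw [comp_apply, adjoint_summand_apply, summand_apply]
  split_ifs with h
  · subst h; simp
  · simp [h]

/-- The block diagonal operator with diagonal entries `T i`. -/
noncomputable def blockDiag (T : ι → H →L[ℂ] H) :
    PiLp 2 (fun _ : ι => H) →L[ℂ] PiLp 2 (fun _ : ι => H) :=
  ∑ i, summand H i ∘L T i ∘L (summand H i)†

theorem blockDiag_apply (T : ι → H →L[ℂ] H) (w : PiLp 2 (fun _ : ι => H)) (i : ι) :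
    blockDiag T w i = T i (w i) := by
  rw [blockDiag, sum_apply, WithLp.ofLp_sum, Finset.sum_apply, Finset.sum_eq_single i]
  · simp [summand_apply, adjoint_summand_apply]
  · intro j _ hj
    simp [summand_apply, hj.symm]
  · simp

theorem blockDiag_comp_summand (T : ι → H →L[ℂ] H) (j : ι) :
    blockDiag T ∘L summand H j = summand H j ∘L T j := by
  ext v i
  rw [comp_apply, blockDiag_apply, comp_apply, summand_apply, summand_apply]
  by_cases h : i = j
  · subst h; simp
  · simp [h]

theorem blockDiag_mul (S T : ι → H →L[ℂ] H) :
    blockDiag S * blockDiag T = blockDiag fun i => S i * T i := by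
  ext w i
  simp [blockDiag_apply]

theorem blockDiag_one : blockDiag (fun _ : ι => (1 : H →L[ℂ] H)) = 1 := by
  ext w i
  simp [blockDiag_apply]

theorem blockDiag_zero : blockDiag (fun _ : ι => (0 : H →L[ℂ] H)) = 0 := by
  ext w i
  simp [blockDiag_apply]

theorem sum_blockDiag {κ : Type*} (s : Finset κ) (T : κ → ι → H →L[ℂ] H) :
    ∑ c ∈ s, blockDiag (T c) = blockDiag fun i => ∑ c ∈ s, T c i := by
  ext w i
  simp [blockDiag_apply]

theorem star_blockDiag (T : ι → H →L[ℂ] H) :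
    star (blockDiag T) = blockDiag fun i => star (T i) := by
  simp [blockDiag, star_eq_adjoint, adjoint_comp, comp_assoc]

theorem isPositive_blockDiag {T : ι → H →L[ℂ] H} (hT : ∀ i, (T i).IsPositive) :
    (blockDiag T).IsPositive := by
  rw [← nonneg_iff_isPositive]
  exact Finset.sum_nonneg fun i _ =>
    (nonneg_iff_isPositive _).2 ((hT i).conj_adjoint (summand H i))

variable {K : ℕ}

theorem IsProjectiveMeasurement.isPOVM {E : Fin K → H →L[ℂ] H} (hE : IsProjectiveMeasurement E) :
    IsPOVM E where
  positive c := by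
    have h : star (E c) * E c = E c := by
      rw [(hE.selfAdjoint c).star_eq, hE.orthogonal, if_pos rfl]
    rw [← nonneg_iff_isPositive, ← h]
    exact star_mul_self_nonneg _
  complete := hE.complete

theorem IsProjectiveMeasurement.const_blockDiag {E : Fin K → H →L[ℂ] H}
    (hE : IsProjectiveMeasurement E) :
    IsProjectiveMeasurement fun c => blockDiag fun _ : ι => E c where
  selfAdjoint c := by
    rw [IsSelfAdjoint, star_blockDiag, (hE.selfAdjoint c).star_eq]
  orthogonal c c' := by
    rw [blockDiag_mul, hE.orthogonal]
    split_ifs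
    · rfl
    · exact blockDiag_zero
  complete := by rw [sum_blockDiag, hE.complete, blockDiag_one]

theorem IsPOVM.const_blockDiag {E : Fin K → H →L[ℂ] H} (hE : IsPOVM E) :
    IsPOVM fun c => blockDiag fun _ : ι => E c where
  positive c := isPositive_blockDiag fun _ => hE.positive c
  complete := by rw [sum_blockDiag, hE.complete, blockDiag_one]

/-- A labelling of the summands by outcomes gives a projective measurement of the label. -/
theorem isProjectiveMeasurement_label (f : ι → Fin K) :
    IsProjectiveMeasurement fun a => blockDiag fun i => if f i = a then (1 : H →L[ℂ] H) else 0 where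
  selfAdjoint a := by
    rw [IsSelfAdjoint, star_blockDiag]
    congr 1; ext1 i
    split_ifs <;> simp
  orthogonal a b := by
    rw [blockDiag_mul, ← blockDiag_zero, ← apply_ite (blockDiag (H := H) (ι := ι))]
    congr 1; ext1 i
    by_cases h : a = b
    · subst h
      by_cases h' : f i = a <;> simp [h']
    · by_cases h' : f i = a
      · simp [h', h]
      · simp [h', h]
  complete := by
    rw [sum_blockDiag, ← blockDiag_one]
    simp

/-- Conjugating a projective measurement by a self-adjoint unitary. -/
theorem IsProjectiveMeasurement.conj {D : Fin K → H →L[ℂ] H} (hD : IsProjectiveMeasurement D)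
    {U : H →L[ℂ] H} (hU : IsSelfAdjoint U) (hUU : U * U = 1) :
    IsProjectiveMeasurement fun a => U * D a * U where
  selfAdjoint a := by
    have h := (hD.selfAdjoint a).conjugate U
    rwa [hU.star_eq] at h
  orthogonal a b := by
    calc U * D a * U * (U * D b * U) = U * D a * (U * U) * D b * U := by simp only [mul_assoc]
      _ = U * (D a * D b) * U := by rw [hUU]; simp only [mul_assoc, mul_one]
      _ = _ := by rw [hD.orthogonal]; split_ifs <;> simp
  complete := by
    rw [← Finset.sum_mul, ← Finset.mul_sum, hD.complete, mul_one, hUU]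

/-! ### Naimark dilation and its commutant. -/

/-- The Naimark isometry of a POVM, landing in the summands labelled by the outcomes. -/
noncomputable def naimark (E : Fin K → H →L[ℂ] H) :
    H →L[ℂ] PiLp 2 (fun _ : Option (Fin K) => H) :=
  ∑ a, summand H (some a) ∘L CFC.sqrt (E a)

variable {E : Fin K → H →L[ℂ] H}

theorem isSelfAdjoint_sqrt (T : H →L[ℂ] H) : (CFC.sqrt T)† = CFC.sqrt T :=
  (CFC.sqrt_nonneg T).isSelfAdjoint

theorem adjoint_naimark_comp_sum (R : Fin K → H →L[ℂ] H) :
    (naimark E)† ∘L (∑ a, summand H (some a) ∘L R a) = ∑ a, CFC.sqrt (E a) * R a := by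
  simp only [naimark, map_sum, adjoint_comp, isSelfAdjoint_sqrt, comp_finsetSum,
    finsetSum_comp]
  refine Finset.sum_congr rfl fun a _ => ?_
  rw [Finset.sum_eq_single a]
  · rw [comp_assoc, ← comp_assoc ((summand H (some a))†), adjoint_summand_comp, if_pos rfl]
    rfl
  · intro b _ hb
    rw [comp_assoc, ← comp_assoc ((summand H (some b))†), adjoint_summand_comp,
      if_neg (by simpa using hb)]
    simp
  · simp

theorem blockDiag_comp_naimark (T : Option (Fin K) → H →L[ℂ] H) :
    blockDiag T ∘L naimark E = ∑ a, summand H (some a) ∘L (T (some a) * CFC.sqrt (E a)) := by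
  simp only [naimark, comp_finsetSum, ← comp_assoc, blockDiag_comp_summand]
  rfl

theorem IsPOVM.adjoint_naimark_comp_naimark (hE : IsPOVM E) :
    (naimark E)† ∘L naimark E = 1 := by
  rw [← hE.complete]
  nth_rw 2 [naimark]
  rw [adjoint_naimark_comp_sum]
  exact Finset.sum_congr rfl fun a _ =>
    CFC.sqrt_mul_sqrt_self _ ((nonneg_iff_isPositive _).2 (hE.positive a))

/-- This orthogonality is why an extra summand is adjoined: it lets one explicit reflection carry
`summand H none` to `naimark E`. -/
theorem adjoint_naimark_comp_summand_none : (naimark E)† ∘L summand H none = 0 := by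
  simp only [naimark, map_sum, adjoint_comp, finsetSum_comp, comp_assoc, adjoint_summand_comp]
  simp

theorem adjoint_summand_none_comp_naimark : (summand H none)† ∘L naimark E = 0 := by
  simp only [naimark, comp_finsetSum, ← comp_assoc, adjoint_summand_comp]
  simp

/-- An operator commuting with `E a` commutes with its square root, by functional calculus. -/
theorem blockDiag_comp_naimark_of_commute {T : H →L[ℂ] H} (hT : ∀ a, Commute (E a) T) :
    blockDiag (fun _ => T) ∘L naimark E = naimark E ∘L T := by
  rw [blockDiag_comp_naimark, naimark, finsetSum_comp]
  refine Finset.sum_congr rfl fun a _ => ?_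
  have h : Commute (CFC.sqrt (E a)) T := (hT a).cfcₙ_nnreal _
  rw [comp_assoc, ← h.eq]
  rfl

/-- The difference between the embedding as the distinguished summand and the Naimark isometry. -/
noncomputable def naimarkDiff (E : Fin K → H →L[ℂ] H) :
    H →L[ℂ] PiLp 2 (fun _ : Option (Fin K) => H) :=
  summand H none - naimark E

/-- The reflection exchanging the distinguished summand with the range of the Naimark isometry. -/
noncomputable def naimarkSwap (E : Fin K → H →L[ℂ] H) :
    PiLp 2 (fun _ : Option (Fin K) => H) →L[ℂ] PiLp 2 (fun _ : Option (Fin K) => H) :=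
  1 - naimarkDiff E ∘L (naimarkDiff E)†

theorem isSelfAdjoint_naimarkSwap : IsSelfAdjoint (naimarkSwap E) := by
  rw [IsSelfAdjoint, star_eq_adjoint, naimarkSwap, map_sub, adjoint_comp, adjoint_adjoint]
  congr 1
  exact star_one _

theorem IsPOVM.naimarkSwap_mul_self (hE : IsPOVM E) : naimarkSwap E * naimarkSwap E = 1 := by
  -- Two isometries with orthogonal ranges: their difference is `√2` times an isometry, so the swap
  -- is `1 - 2P` with `P` a projection.
  have h : (naimarkDiff E)† ∘L naimarkDiff E = 1 + 1 := by
    simp only [naimarkDiff, map_sub, sub_comp, comp_sub, hE.adjoint_naimark_comp_naimark,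
      adjoint_naimark_comp_summand_none, adjoint_summand_none_comp_naimark, adjoint_summand_comp]
    simp
  have h2 : (naimarkDiff E ∘L (naimarkDiff E)†) * (naimarkDiff E ∘L (naimarkDiff E)†) =
      naimarkDiff E ∘L (naimarkDiff E)† + naimarkDiff E ∘L (naimarkDiff E)† := by
    rw [mul_def, comp_assoc, ← comp_assoc ((naimarkDiff E)†), h, add_comp, comp_add]
    rfl
  rw [naimarkSwap]
  generalize naimarkDiff E ∘L (naimarkDiff E)† = X at h2
  rw [sub_mul, mul_sub X, h2]
  simp

theorem naimarkSwap_comp_summand_none :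
    naimarkSwap E ∘L summand H none = naimark E := by
  have h : (naimarkDiff E)† ∘L summand H none = 1 := by
    simp only [naimarkDiff, map_sub, sub_comp,
      adjoint_naimark_comp_summand_none, adjoint_summand_comp]
    simp
  rw [naimarkSwap, sub_comp, comp_assoc, h, naimarkDiff]
  ext1 v
  simp

theorem commute_naimarkSwap {T : H →L[ℂ] H} (hE : IsPOVM E) (hT : ∀ a, Commute (E a) T) :
    Commute (naimarkSwap E) (blockDiag fun _ => T) := by
  have key : ∀ S : H →L[ℂ] H, (∀ a, Commute (E a) S) →
      blockDiag (fun _ => S) ∘L naimarkDiff E = naimarkDiff E ∘L S := by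
    intro S hS
    rw [naimarkDiff, comp_sub, blockDiag_comp_summand, blockDiag_comp_naimark_of_commute hS,
      sub_comp]
  -- The intertwining relation for `star T`, once adjoints are taken, gives the one needed for the
  -- adjoint of `naimarkDiff E`.
  have hT' : ∀ a, Commute (E a) (star T) := fun a => by
    have h := (hT a).star_star
    rwa [show star (E a) = E a from (hE.positive a).isSelfAdjoint] at h
  have h2 : (naimarkDiff E)† ∘L blockDiag (fun _ => T) = T ∘L (naimarkDiff E)† := by
    have h := congrArg (fun S => adjoint S) (key _ hT')
    simp only [adjoint_comp] at h
    rwa [← star_eq_adjoint, star_blockDiag, ← star_eq_adjoint, star_star] at h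
  refine (Commute.one_left _).sub_left ?_
  rw [Commute, SemiconjBy, mul_def, mul_def, comp_assoc, h2, ← comp_assoc (blockDiag _), key _ hT, comp_assoc]

/-- The dilation of a POVM to a projective measurement; `a₀` is the outcome assigned to the
distinguished summand. -/
noncomputable def dilation (a₀ : Fin K) (E : Fin K → H →L[ℂ] H) (a : Fin K) :
    PiLp 2 (fun _ : Option (Fin K) => H) →L[ℂ] PiLp 2 (fun _ : Option (Fin K) => H) :=
  naimarkSwap E * (blockDiag fun i => if i.getD a₀ = a then 1 else 0) * naimarkSwap E

theorem IsPOVM.isProjectiveMeasurement_dilation (hE : IsPOVM E) (a₀ : Fin K) :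
    IsProjectiveMeasurement (dilation a₀ E) :=
  (isProjectiveMeasurement_label fun i : Option (Fin K) => i.getD a₀).conj
    isSelfAdjoint_naimarkSwap hE.naimarkSwap_mul_self

theorem IsPOVM.commute_dilation (hE : IsPOVM E) (a₀ a : Fin K) {T : H →L[ℂ] H}
    (hT : ∀ a, Commute (E a) T) : Commute (dilation a₀ E a) (blockDiag fun _ => T) := by
  have h := commute_naimarkSwap hE hT
  refine (h.mul_left ?_).mul_left h
  rw [Commute, SemiconjBy, blockDiag_mul, blockDiag_mul]
  congr 1; ext1 i
  split_ifs <;> simp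

/-- The swap turns the embedding into the Naimark isometry, whose `a`-th block contributes `√E_a
√E_a`. That isometry has no component in the distinguished summand, so the choice of `a₀` is
immaterial. -/
theorem IsPOVM.compression_dilation (hE : IsPOVM E) (a₀ a : Fin K) :
    (summand H none)† ∘L dilation a₀ E a ∘L summand H none = E a := by
  have h : (summand H none)† ∘L naimarkSwap E = (naimark E)† := by
    rw [← naimarkSwap_comp_summand_none, adjoint_comp]
    congr 1
    exact isSelfAdjoint_naimarkSwap.symm
  rw [dilation, mul_def, mul_def, comp_assoc, naimarkSwap_comp_summand_none, comp_assoc,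
    ← comp_assoc, h, blockDiag_comp_naimark, adjoint_naimark_comp_sum, Finset.sum_eq_single a]
  · simpa using CFC.sqrt_mul_sqrt_self _ ((nonneg_iff_isPositive _).2 (hE.positive a))
  · intro b _ hb
    simp [hb]
  · simp

theorem IsPOVM.compression_dilation_mul (hE : IsPOVM E) (a₀ a : Fin K) (T : H →L[ℂ] H) :
    (summand H none)† ∘L (dilation a₀ E a * blockDiag fun _ => T) ∘L summand H none = E a * T := by
  conv_rhs => rw [← hE.compression_dilation a₀ a]
  rw [mul_def, comp_assoc, blockDiag_comp_summand]
  rfl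

end Dilation


/-! ### Transport of states along isometries. -/

section Compression

open ContinuousLinearMap
open scoped InnerProduct

variable {H H' : Type u} [NormedAddCommGroup H] [InnerProductSpace ℂ H] [CompleteSpace H]
  [NormedAddCommGroup H'] [InnerProductSpace ℂ H'] [CompleteSpace H']

/-- The state on `B(H')` obtained from a state on `B(H)` and an isometry `s : H → H'`, by
compressing operators along `s`. -/
noncomputable def State.compress (ω : State H) (s : H →L[ℂ] H') (hs : s† ∘L s = 1) : State H' where
  toFunctional := PositiveLinearMap.mk₀
    { toFun := fun T => ω.toFunctional (s† ∘L T ∘L s)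
      map_add' := fun S T => by rw [add_comp, comp_add, map_add]
      map_smul' := fun c T => by rw [smul_comp, comp_smul, map_smul, RingHom.id_apply] }
    fun T hT => map_nonneg ω.toFunctional <|
      (nonneg_iff_isPositive _).2 (((nonneg_iff_isPositive T).1 hT).adjoint_conj s)
  map_one := by
    change ω.toFunctional (s† ∘L (1 : H' →L[ℂ] H') ∘L s) = 1
    rw [show (1 : H' →L[ℂ] H') ∘L s = s from id_comp s, hs, ω.map_one]

theorem State.compress_apply (ω : State H) (s : H →L[ℂ] H') (hs : s† ∘L s = 1)
    (T : H' →L[ℂ] H') :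
    (ω.compress s hs).toFunctional T = ω.toFunctional (s† ∘L T ∘L s) := rfl

end Compression

/-! ### Tensor products of bounded maps between different spaces. -/

section TensorMaps

open ContinuousLinearMap
open scoped InnerProduct

variable {A A' A'' B B' B'' : Type u}
  [NormedAddCommGroup A] [InnerProductSpace ℂ A] [NormedAddCommGroup B] [InnerProductSpace ℂ B]
  [NormedAddCommGroup A'] [InnerProductSpace ℂ A'] [NormedAddCommGroup B'] [InnerProductSpace ℂ B']
  [NormedAddCommGroup A''] [InnerProductSpace ℂ A'']
  [NormedAddCommGroup B''] [InnerProductSpace ℂ B'']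

/-- The bounded operator `S ⊗ T` between Hilbert space tensor products. -/
noncomputable def tensorMap (S : A →L[ℂ] A') (T : B →L[ℂ] B') :
    HilbertTensor A B →L[ℂ] HilbertTensor A' B' :=
  (TensorProduct.mapL S T).completion

theorem tensorMap_coe (S : A →L[ℂ] A') (T : B →L[ℂ] B') (z : A ⊗[ℂ] B) :
    tensorMap S T (z : HilbertTensor A B) =
      (TensorProduct.mapL S T z : A' ⊗[ℂ] B') := by
  simp [tensorMap]

theorem tensorMap_comp (S' : A' →L[ℂ] A'') (T' : B' →L[ℂ] B'') (S : A →L[ℂ] A') (T : B →L[ℂ] B') :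
    tensorMap S' T' ∘L tensorMap S T = tensorMap (S' ∘L S) (T' ∘L T) := by
  ext z
  induction z using UniformSpace.Completion.induction_on with
  | hp => exact isClosed_eq (ContinuousLinearMap.continuous _) (ContinuousLinearMap.continuous _)
  | ih z => rw [comp_apply, tensorMap_coe, tensorMap_coe, tensorMap_coe, TensorProduct.mapL_comp]; rfl

theorem tensorMap_one : tensorMap (1 : A →L[ℂ] A) (1 : B →L[ℂ] B) = 1 := by
  ext z
  induction z using UniformSpace.Completion.induction_on with
  | hp => exact isClosed_eq (ContinuousLinearMap.continuous _) (ContinuousLinearMap.continuous _)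
  | ih z => rw [tensorMap_coe, one_def, one_def, TensorProduct.mapL_id_id]; rfl

theorem inner_mapL_adjoint [CompleteSpace A] [CompleteSpace A'] [CompleteSpace B] [CompleteSpace B']
    (S : A →L[ℂ] A') (T : B →L[ℂ] B') (z : A' ⊗[ℂ] B') (w : A ⊗[ℂ] B) :
    inner ℂ (TensorProduct.mapL (S†) (T†) z) w = inner ℂ z (TensorProduct.mapL S T w) := by
  induction z with
  | zero => simp
  | add x y hx hy => rw [map_add, inner_add_left, inner_add_left, hx, hy]
  | tmul a b =>
    induction w with
    | zero => simp
    | add x y hx hy => rw [map_add, inner_add_right, inner_add_right, hx, hy]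
    | tmul c d =>
      rw [TensorProduct.mapL_tmul, TensorProduct.mapL_tmul, TensorProduct.inner_tmul,
        TensorProduct.inner_tmul, adjoint_inner_left, adjoint_inner_left]

theorem adjoint_tensorMap [CompleteSpace A] [CompleteSpace A'] [CompleteSpace B] [CompleteSpace B']
    (S : A →L[ℂ] A') (T : B →L[ℂ] B') : (tensorMap S T)† = tensorMap (S†) (T†) := by
  symm
  rw [eq_adjoint_iff]
  intro z w
  induction z, w using UniformSpace.Completion.induction_on₂ with
  | hp =>
    exact isClosed_eq (((ContinuousLinearMap.continuous _).comp continuous_fst).inner continuous_snd)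
      (continuous_fst.inner ((ContinuousLinearMap.continuous _).comp continuous_snd))
  | ih z w =>
    rw [tensorMap_coe, tensorMap_coe, UniformSpace.Completion.inner_coe,
      UniformSpace.Completion.inner_coe, inner_mapL_adjoint]

end TensorMaps

/-! ### The four inclusions. -/

theorem commutingSet_subset_commutingSetPOVM (N K : ℕ) :
    commutingSet.{u} N K ⊆ commutingSetPOVM.{u} N K := by
  rintro p ⟨H, _, _, _, E, F, ω, hE, hF, hEF, hp⟩
  exact ⟨H, _, _, inferInstance, E, F, ω, fun x => (hE x).isPOVM, fun y => (hF y).isPOVM, hEF, hp⟩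

theorem tensorSet_subset_tensorSetPOVM (N K : ℕ) :
    tensorSet.{u} N K ⊆ tensorSetPOVM.{u} N K := by
  rintro p ⟨HA, _, _, _, HB, _, _, _, E, F, ω, hE, hF, hp⟩
  exact ⟨HA, _, _, inferInstance, HB, _, _, inferInstance, E, F, ω,
    fun x => (hE x).isPOVM, fun y => (hF y).isPOVM, hp⟩

section

open ContinuousLinearMap

/-- Commuting POVMs can be dilated so that the first ones become projective, the second ones stay
POVMs, and remain projective if they were. -/
theorem exists_commuting_dilation {N K : ℕ} (a₀ : Fin K) {H : Type u} [NormedAddCommGroup H]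
    [InnerProductSpace ℂ H] [CompleteSpace H] {E F : Fin N → Fin K → H →L[ℂ] H} (ω : State H)
    (hE : ∀ x, IsPOVM (E x)) (hF : ∀ y, IsPOVM (F y)) (hEF : ∀ a b x y, Commute (E x a) (F y b)) :
    ∃ (H' : Type u) (_ : NormedAddCommGroup H') (_ : InnerProductSpace ℂ H')
      (_ : CompleteSpace H') (E' F' : Fin N → Fin K → H' →L[ℂ] H') (ω' : State H'),
      (∀ x, IsProjectiveMeasurement (E' x)) ∧ (∀ y, IsPOVM (F' y)) ∧
      (∀ y, IsProjectiveMeasurement (F y) → IsProjectiveMeasurement (F' y)) ∧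
      (∀ a b x y, Commute (E' x a) (F' y b)) ∧
      ∀ a b x y, ω'.toFunctional (E' x a * F' y b) = ω.toFunctional (E x a * F y b) := by
  have hs : adjoint (summand H (none : Option (Fin K))) ∘L summand H none = 1 := by
    rw [adjoint_summand_comp, if_pos rfl]
  refine ⟨PiLp 2 fun _ : Option (Fin K) => H, _, _, inferInstance, fun x => dilation a₀ (E x),
    fun y b => blockDiag fun _ => F y b, ω.compress (summand H none) hs,
    fun x => (hE x).isProjectiveMeasurement_dilation a₀, fun y => (hF y).const_blockDiag,
    fun y h => h.const_blockDiag,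
    fun a b x y => (hE x).commute_dilation a₀ a fun a => hEF a b x y, fun a b x y => ?_⟩
  rw [State.compress_apply, (hE x).compression_dilation_mul]

theorem commutingSetPOVM_subset_commutingSet (N K : ℕ) :
    commutingSetPOVM.{u} N K ⊆ commutingSet.{u} N K := by
  rintro p ⟨H, _, _, _, E, F, ω, hE, hF, hEF, hp⟩
  -- Without outcomes there is no `a₀`, but a POVM is then vacuously projective.
  rcases Nat.eq_zero_or_pos K with rfl | hK
  · exact ⟨H, _, _, inferInstance, E, F, ω,
      fun x => ⟨fun a => a.elim0, fun a => a.elim0, (hE x).complete⟩,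
      fun x => ⟨fun a => a.elim0, fun a => a.elim0, (hF x).complete⟩, hEF, hp⟩
  obtain ⟨H₁, _, _, _, E₁, F₁, ω₁, hE₁, hF₁, -, hEF₁, h₁⟩ :=
    exists_commuting_dilation ⟨0, hK⟩ ω hE hF hEF
  -- The roles are exchanged: the second dilation makes the other party projective and only
  -- amplifies `E₁`, which stays projective.
  obtain ⟨H₂, _, _, _, F₂, E₂, ω₂, hF₂, -, hE₂, hFE₂, h₂⟩ :=
    exists_commuting_dilation ⟨0, hK⟩ ω₁ hF₁ (fun x => (hE₁ x).isPOVM)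
      fun b a y x => (hEF₁ a b x y).symm
  refine ⟨H₂, _, _, inferInstance, E₂, F₂, ω₂, fun x => hE₂ x (hE₁ x), hF₂,
    fun a b x y => (hFE₂ b a y x).symm, fun a b x y => ?_⟩
  rw [hp, ← h₁, (hEF₁ a b x y).eq, ← h₂, (hFE₂ b a y x).eq]

theorem tensorSetPOVM_subset_tensorSet (N K : ℕ) :
    tensorSetPOVM.{u} N K ⊆ tensorSet.{u} N K := by
  rintro p ⟨HA, _, _, _, HB, _, _, _, E, F, ω, hE, hF, hp⟩
  rcases Nat.eq_zero_or_pos K with rfl | hK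
  · exact ⟨HA, _, _, inferInstance, HB, _, _, inferInstance, E, F, ω,
      fun x => ⟨fun a => a.elim0, fun a => a.elim0, (hE x).complete⟩,
      fun x => ⟨fun a => a.elim0, fun a => a.elim0, (hF x).complete⟩, hp⟩
  let a₀ : Fin K := ⟨0, hK⟩
  let s := summand HA (none : Option (Fin K))
  let t := summand HB (none : Option (Fin K))
  have hst : (adjoint (tensorMap s t)) ∘L tensorMap s t = 1 := by
    rw [adjoint_tensorMap, tensorMap_comp, adjoint_summand_comp, adjoint_summand_comp,
      if_pos rfl, if_pos rfl, tensorMap_one]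
  refine ⟨PiLp 2 fun _ : Option (Fin K) => HA, _, _, inferInstance,
    PiLp 2 fun _ : Option (Fin K) => HB, _, _, inferInstance,
    fun x => dilation a₀ (E x), fun y => dilation a₀ (F y), ω.compress (tensorMap s t) hst,
    fun x => (hE x).isProjectiveMeasurement_dilation a₀,
    fun y => (hF y).isProjectiveMeasurement_dilation a₀, fun a b x y => ?_⟩
  have h : adjoint (tensorMap s t) ∘L
      opTensor (dilation a₀ (E x) a) (dilation a₀ (F y) b) ∘L tensorMap s t =
      opTensor (E x a) (F y b) := by
    -- `opTensor` is definitionally `tensorMap` on endomorphisms, so the compression can be computed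
    -- factor by factor.
    change adjoint (tensorMap s t) ∘L
      tensorMap (dilation a₀ (E x) a) (dilation a₀ (F y) b) ∘L tensorMap s t = tensorMap _ _
    rw [adjoint_tensorMap, tensorMap_comp, tensorMap_comp, (hE x).compression_dilation,
      (hF y).compression_dilation]
  rw [hp, State.compress_apply, h]

end

end Tsirelson

theorem mainTheorem7 (N K : ℕ) :
    Tsirelson.tensorSet.{u} N K = Tsirelson.tensorSetPOVM.{u} N K ∧
      Tsirelson.commutingSet.{u} N K = Tsirelson.commutingSetPOVM.{u} N K :=
  ⟨(Tsirelson.tensorSet_subset_tensorSetPOVM N K).antisymm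
      (Tsirelson.tensorSetPOVM_subset_tensorSet N K),
    (Tsirelson.commutingSet_subset_commutingSetPOVM N K).antisymm
      (Tsirelson.commutingSetPOVM_subset_commutingSet N K)⟩
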